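/- All vector spaces are finite-dimensional over $\mathbb R$. Let $S : \mathsf{Vec} \to \mathsf{CMon}$ be a functor from the category of finite-dimensional real vector spaces and linear maps to the category of commutative monoids and monoid homomorphisms (a decoration functor). Let $\mathsf{Lin}_S$ be the category whose objects are vector spaces and whose morphisms $X \to Y$ are pairs $(f,s)$ with $f : X \to Y$ linear and $s \in S(Y)$, with composition $(f,t)\circ(g,s) = (fg,\; t + S(f)(s))$ and identities $(\mathrm{id},0)$. Let $\mathsf{LinRel}_S$ be the category whose objects are vector spaces and whose morphisms $X \to Y$ are triples $(D,f,s)$ with $D \subseteq Y$ a subspace, $f : X \to Y/D$ linear and $s \in S(Y/D)$. The composite of $(D,g,s) : X \to Y$ and $(E,f,t) : Y \to Z$ is $(F,\; \tilde f g,\; S(\tilde f)(s) + S(Z/E \to Z/F)(t))$, where $F = E + f[D]$ (that is, the preimage in $Z$ of $f[D] \subseteq Z/E$) and $\tilde f : Y/D \to Z/F$ is the map induced by $f$. Both are symmetric monoidal with $X \otimes Y = X \times Y$ and unit object $0$. On morphisms, $(f,s)\otimes(g,t) = (f\times g,\; s\oplus t)$ in $\mathsf{Lin}_S$, where $s \oplus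 t = S(i_X)(s) + S(i_Y)(t)$ for the inclusions $i_X, i_Y$ of the two factors of the codomain; and $(D,f,s)\otimes(E,g,t) = (D \times E,\; \theta\,(f\times g),\; S(\theta)(s \oplus t))$ in $\mathsf{LinRel}_S$, where $\theta : X/D \times Y/E \cong (X\times Y)/(D\times E)$. Copying $X \to X \otimes X$ and discarding $X \to 0$ are given in both by the linear maps $x \mapsto (x,x)$ and $x \mapsto 0$ (with zero decoration and $D=0$). When $S(0)$ is trivial, both are Markov categories. A category with such copy and discard maps is said to have conditionals if for every morphism $f : A \to X \otimes Y$ there is a morphism $f_{|X} : X \otimes A \to Y$ such that $$f = (\mathrm{id}_X \otimes f_{|X}) \circ (\mathsf{copy}_X \otimes \mathrm{id}_A) \circ (f_X \otimes \mathrm{id}_A)\circ \mathsf{copy}_A ,$$ where $f_X = (\mathrm{id}_X \otimes \mathsf{del}_Y)\circ f : A \to X$ is the marginal of $f$ (coherence isomorphisms suppressed). Theorem. For every decoration functor $S$, if $\mathsf{Lin}_S$ has conditionals, then $\mathsf{LinRel}_S$ has conditionals. -/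

import Mathlib

open CategoryTheory MonoidalCategory ComonObj

universe u v w

namespace DecoratedLinear

/-- A copy-discard category (in particular, a Markov category) has conditionals if every
`f : A ⟶ X ⊗ Y` has a conditional `g = f_{|X} : X ⊗ A ⟶ Y`, meaning that `f` agrees with the
following process: copy the input `A`; run the marginal `f_X : A ⟶ X` (that is, `f` with the output
`Y` discarded) on the first copy; copy its output `X`; return the first copy of `X`, together with
the result of running `g` on the second copy of `X` and the second copy of `A`. -/
def HasConditionals (C : Type u) [Category.{v} C] [MonoidalCategory C] [CopyDiscardCategory C] :
    Prop :=
  ∀ (A X Y : C) (f : A ⟶ X ⊗ Y), ∃ g : X ⊗ A ⟶ Y,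
    f = Δ[A] ≫ (f ≫ X ◁ ε[Y] ≫ (ρ_ X).hom) ▷ A ≫ Δ[X] ▷ A ≫ (α_ X X A).hom ≫ X ◁ g

set_option linter.checkUnivs false in
/-- Decoration functors: functors from finite-dimensional real vector spaces to commutative
monoids (written additively). -/
abbrev DecorationFunctor : Type _ := FGModuleCat.{u} ℝ ⥤ AddCommMonCat.{v}

section Unbundled

set_option linter.unusedSectionVars false

/-- The commutative monoid `S(X)`. -/
abbrev Dec (S : DecorationFunctor.{u, v}) (X : Type u) [AddCommGroup X] [Module ℝ X]
    [Module.Finite ℝ X] : Type v := S.obj (FGModuleCat.of ℝ X)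

variable (S : DecorationFunctor.{u, v})
variable {X Y Z W X' Y' Z' : Type u}
  [AddCommGroup X] [Module ℝ X] [Module.Finite ℝ X]
  [AddCommGroup Y] [Module ℝ Y] [Module.Finite ℝ Y]
  [AddCommGroup Z] [Module ℝ Z] [Module.Finite ℝ Z]
  [AddCommGroup W] [Module ℝ W] [Module.Finite ℝ W]
  [AddCommGroup X'] [Module ℝ X'] [Module.Finite ℝ X']
  [AddCommGroup Y'] [Module ℝ Y'] [Module.Finite ℝ Y']
  [AddCommGroup Z'] [Module ℝ Z'] [Module.Finite ℝ Z']

/-- The monoid homomorphism `S(f) : S(X) → S(Y)`. -/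
def push (f : X →ₗ[ℝ] Y) : Dec S X →+ Dec S Y := (S.map (FGModuleCat.ofHom f)).hom

@[simp] lemma push_id : push S (LinearMap.id : X →ₗ[ℝ] X) = AddMonoidHom.id (Dec S X) := by
  have h : FGModuleCat.ofHom (LinearMap.id : X →ₗ[ℝ] X) = 𝟙 (FGModuleCat.of ℝ X) := rfl
  rw [push, h, S.map_id]; rfl

@[simp] lemma push_push (g : Y →ₗ[ℝ] Z) (f : X →ₗ[ℝ] Y) (s : Dec S X) :
    push S g (push S f s) = push S (g ∘ₗ f) s := by
  have h : FGModuleCat.ofHom (g ∘ₗ f) = FGModuleCat.ofHom f ≫ FGModuleCat.ofHom g := rfl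
  simp only [push, h, S.map_comp]; rfl

lemma push_congr {f g : X →ₗ[ℝ] Y} (h : ∀ x, f x = g x) (s : Dec S X) :
    push S f s = push S g s := by
  rw [LinearMap.ext h]

lemma push_eq_self {f : X →ₗ[ℝ] X} (h : ∀ x, f x = x) (s : Dec S X) :
    push S f s = s := by
  rw [show f = LinearMap.id from LinearMap.ext h]; simp

/-- The lax monoidal structure maps `S(X) × S(Y) → S(X × Y)`,
`(s, t) ↦ S(i_X)(s) + S(i_Y)(t)`. -/
def decSum (s : Dec S X) (t : Dec S Y) : Dec S (X × Y) :=
  push S (LinearMap.inl ℝ X Y) s + push S (LinearMap.inr ℝ X Y) t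

/-- `S`-decorated linear maps `X → Y`: pairs `(f, s)` of a linear map `f : X → Y` and a
decoration `s ∈ S(Y)`. -/
@[ext] structure DecMap (S : DecorationFunctor.{u, v}) (X Y : Type u)
    [AddCommGroup X] [Module ℝ X] [Module.Finite ℝ X]
    [AddCommGroup Y] [Module ℝ Y] [Module.Finite ℝ Y] : Type (max u v) where
  lin : X →ₗ[ℝ] Y
  dec : Dec S Y

variable {S}

namespace DecMap

variable (S) in
/-- A linear map with trivial decoration. -/
@[simps] def ofLin (f : X →ₗ[ℝ] Y) : DecMap S X Y := ⟨f, 0⟩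

/-- `(f, t) ∘ (g, s) = (f g, t + S(f)(s))`, in diagrammatic order. -/
@[simps] def comp (g : DecMap S X Y) (f : DecMap S Y Z) : DecMap S X Z :=
  ⟨f.lin ∘ₗ g.lin, f.dec + push S f.lin g.dec⟩

/-- The tensor product of decorated maps. -/
@[simps] def tensor (f : DecMap S X Y) (g : DecMap S X' Y') : DecMap S (X × X') (Y × Y') :=
  ⟨f.lin.prodMap g.lin, decSum S f.dec g.dec⟩

lemma id_comp (f : DecMap S X Y) : (ofLin S LinearMap.id).comp f = f := by
  ext <;> simp

lemma comp_id (f : DecMap S X Y) : f.comp (ofLin S LinearMap.id) = f := by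
  ext <;> simp

lemma assoc (f : DecMap S X Y) (g : DecMap S Y Z) (h : DecMap S Z W) :
    (f.comp g).comp h = f.comp (g.comp h) := by
  ext <;> simp [add_assoc]

lemma ofLin_comp (f : X →ₗ[ℝ] Y) (g : Y →ₗ[ℝ] Z) :
    (ofLin S f).comp (ofLin S g) = ofLin S (g ∘ₗ f) := by
  ext <;> simp

lemma ofLin_tensor (f : X →ₗ[ℝ] Y) (g : X' →ₗ[ℝ] Y') :
    (ofLin S f).tensor (ofLin S g) = ofLin S (f.prodMap g) := by
  ext <;> simp [decSum]

lemma tensor_comp_tensor (f : DecMap S X Y) (f' : DecMap S X' Y') (g : DecMap S Y Z)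
    (g' : DecMap S Y' Z') :
    (f.tensor f').comp (g.tensor g') = (f.comp g).tensor (f'.comp g') := by
  ext1
  · rfl
  · simp only [comp_dec, tensor_dec, tensor_lin, decSum, map_add, push_push]
    rw [add_add_add_comm]
    congr 2 <;> exact push_congr S (fun x => by simp) _

lemma assoc_nat (f : DecMap S X Y) (g : DecMap S X' Y') (h : DecMap S Z W) :
    ((f.tensor g).tensor h).comp (ofLin S (LinearEquiv.prodAssoc ℝ Y Y' W).toLinearMap) =
      (ofLin S (LinearEquiv.prodAssoc ℝ X X' Z).toLinearMap).comp (f.tensor (g.tensor h)) := by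
  ext1
  · rfl
  · simp only [comp_dec, tensor_dec, ofLin_dec, ofLin_lin, decSum, map_add, push_push,
      map_zero, zero_add, add_zero, ← add_assoc]
    congr 2

lemma left_nat (f : DecMap S X Y) :
    ((ofLin S (LinearMap.id : PUnit.{u + 1} →ₗ[ℝ] PUnit.{u + 1})).tensor f).comp
        (ofLin S (LinearMap.snd ℝ PUnit.{u + 1} Y)) = (ofLin S (LinearMap.snd ℝ PUnit.{u + 1} X)).comp f := by
  ext1
  · rfl
  · simp [decSum]

lemma right_nat (f : DecMap S X Y) :
    (f.tensor (ofLin S (LinearMap.id : PUnit.{u + 1} →ₗ[ℝ] PUnit.{u + 1}))).comp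
        (ofLin S (LinearMap.fst ℝ Y PUnit.{u + 1})) = (ofLin S (LinearMap.fst ℝ X PUnit.{u + 1})).comp f := by
  ext1
  · rfl
  · simp [decSum]

lemma braid_nat (f : DecMap S X Y) (g : DecMap S X' Y') :
    (f.tensor g).comp (ofLin S (LinearEquiv.prodComm ℝ Y Y').toLinearMap) =
      (ofLin S (LinearEquiv.prodComm ℝ X X').toLinearMap).comp (g.tensor f) := by
  ext1
  · rfl
  · simp only [comp_dec, tensor_dec, ofLin_dec, ofLin_lin, decSum, map_add, push_push,
      map_zero, zero_add, add_zero]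
    rw [add_comm]
    congr 1

lemma eq_of_subsingleton [Subsingleton Y] [Subsingleton (Dec S Y)] (f g : DecMap S X Y) :
    f = g := by
  ext1
  · exact LinearMap.ext fun x => Subsingleton.elim _ _
  · exact Subsingleton.elim _ _

end DecMap

/-- `S`-decorated linear relations `X → Y`: triples `(D, f, s)` of a subspace `D ⊆ Y` (the locus of
nondeterminism), a linear map `f : X → Y/D` and a decoration `s ∈ S(Y/D)`. -/
structure DecRel (S : DecorationFunctor.{u, v}) (X Y : Type u)
    [AddCommGroup X] [Module ℝ X] [Module.Finite ℝ X]
    [AddCommGroup Y] [Module ℝ Y] [Module.Finite ℝ Y] : Type (max u v) where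
  locus : Submodule ℝ Y
  lin : X →ₗ[ℝ] Y ⧸ locus
  dec : Dec S (Y ⧸ locus)

namespace DecRel

variable (S) in
/-- A linear map `f : X → Y`, seen as the decorated relation with `D = 0` and no decoration. -/
def ofLin (f : X →ₗ[ℝ] Y) : DecRel S X Y := ⟨⊥, (⊥ : Submodule ℝ Y).mkQ ∘ₗ f, 0⟩

/-- For `g : Y → Z/E` and `D ⊆ Y`, the subspace `E + g[D]` of `Z`, i.e. the preimage in `Z` of
`g[D] ⊆ Z/E`. -/
def compLocus (D : Submodule ℝ Y) (E : Submodule ℝ Z) (g : Y →ₗ[ℝ] Z ⧸ E) : Submodule ℝ Z :=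
  (D.map g).comap E.mkQ

lemma le_compLocus (D : Submodule ℝ Y) (E : Submodule ℝ Z) (g : Y →ₗ[ℝ] Z ⧸ E) :
    E ≤ compLocus D E g := by
  intro z hz
  have h : E.mkQ z = 0 := by simpa using hz
  simp only [compLocus, Submodule.mem_comap, h]
  exact zero_mem _

/-- The map `Y/D → Z/(E + g[D])` to which `Y → Z/E → Z/(E + g[D])` descends. -/
def compMap (D : Submodule ℝ Y) (E : Submodule ℝ Z) (g : Y →ₗ[ℝ] Z ⧸ E) :
    Y ⧸ D →ₗ[ℝ] Z ⧸ compLocus D E g :=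
  D.liftQ (Submodule.factor (le_compLocus D E g) ∘ₗ g) (by
    intro y hy
    obtain ⟨z, hz⟩ := E.mkQ_surjective (g y)
    have hz' : z ∈ compLocus D E g := ⟨y, hy, hz.symm⟩
    simpa [← hz] using hz')

/-- The composite of `(D, f, s) : X → Y` and `(E, g, t) : Y → Z`, in diagrammatic order: with
`F = E + g[D]` and `g' : Y/D → Z/F` induced by `g`, it is
`(F, g' f, S(g')(s) + S(Z/E → Z/F)(t))`. -/
def comp (f : DecRel S X Y) (g : DecRel S Y Z) : DecRel S X Z where
  locus := compLocus f.locus g.locus g.lin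
  lin := compMap f.locus g.locus g.lin ∘ₗ f.lin
  dec := push S (compMap f.locus g.locus g.lin) f.dec +
    push S (Submodule.factor (le_compLocus f.locus g.locus g.lin)) g.dec

/-- The canonical isomorphism `X/D × Y/E → (X × Y)/(D × E)`, as a linear map. -/
def prodQuot (D : Submodule ℝ X) (E : Submodule ℝ Y) :
    (X ⧸ D) × (Y ⧸ E) →ₗ[ℝ] (X × Y) ⧸ D.prod E :=
  (D.mapQ (D.prod E) (LinearMap.inl ℝ X Y) fun x hx => by simpa using hx).coprod
    (E.mapQ (D.prod E) (LinearMap.inr ℝ X Y) fun y hy => by simpa using hy)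

/-- The tensor product of decorated relations. -/
def tensor (f : DecRel S X Y) (g : DecRel S X' Y') : DecRel S (X × X') (Y × Y') where
  locus := f.locus.prod g.locus
  lin := prodQuot f.locus g.locus ∘ₗ f.lin.prodMap g.lin
  dec := push S (prodQuot f.locus g.locus) (decSum S f.dec g.dec)

end DecRel

/-- The decoration functor of vector subspaces, with Minkowski sum and direct image. -/
def subFunctor : DecorationFunctor.{u, u} where
  obj X := AddCommMonCat.of (Submodule ℝ X)
  map f := AddCommMonCat.ofHom
    { toFun := Submodule.map f.hom.hom
      map_zero' := Submodule.map_bot _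
      map_add' := fun D E => Submodule.map_sup D E _ }
  map_id X := by ext D : 2; exact Submodule.map_id D
  map_comp f g := by ext D : 2; exact Submodule.map_comp f.hom.hom g.hom.hom D

/-- The product of two decoration functors. -/
def prodFunctor (S : DecorationFunctor.{u, v}) (T : DecorationFunctor.{u, w}) :
    DecorationFunctor.{u, max v w} where
  obj X := AddCommMonCat.of (S.obj X × T.obj X)
  map f := AddCommMonCat.ofHom ((S.map f).hom.prodMap (T.map f).hom)
  map_id X := by ext x : 2; simp
  map_comp f g := by ext x : 2; simp [Prod.map]

variable (S) in
/-- `S`-decorated linear relations before quotienting: triples `(f, s, D)`, with `s ∈ S(Y)`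
and `D ⊆ Y`. -/
abbrev PreRel (X Y : Type u) [AddCommGroup X] [Module ℝ X] [Module.Finite ℝ X]
    [AddCommGroup Y] [Module ℝ Y] [Module.Finite ℝ Y] : Type (max u v) :=
  DecMap (prodFunctor S subFunctor.{u}) X Y

/-- The subspace `D` of a triple `(f, s, D)`. -/
def PreRel.locus (f : PreRel S X Y) : Submodule ℝ Y := f.dec.2

/-- The decoration `s` of a triple `(f, s, D)`. -/
def PreRel.deco (f : PreRel S X Y) : Dec S Y := f.dec.1

namespace DecRel

/-- The decorated relation represented by a triple `(f, s, D)`. -/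
def rep (f : PreRel S X Y) : DecRel S X Y where
  locus := (PreRel.locus f)
  lin := (Submodule.mkQ (PreRel.locus f)) ∘ₗ f.lin
  dec := push S (Submodule.mkQ (PreRel.locus f)) (PreRel.deco f)

lemma rep_eq_mk (p : PreRel S X Y) (D : Submodule ℝ Y) (f : X →ₗ[ℝ] Y ⧸ D) (s : Dec S (Y ⧸ D))
    (h : PreRel.locus p = D) (hf : D.mkQ ∘ₗ p.lin = f)
    (hs : push S D.mkQ (PreRel.deco p) = s) : rep p = ⟨D, f, s⟩ := by
  subst h hf hs
  rfl

lemma rep_surjective : Function.Surjective (rep : PreRel S X Y → DecRel S X Y) := by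
  rintro ⟨D, f, s⟩
  obtain ⟨r, hr⟩ := D.mkQ.exists_rightInverse_of_surjective D.range_mkQ
  refine ⟨⟨r ∘ₗ f, (push S r s, D)⟩, rep_eq_mk _ _ _ _ rfl ?_ ?_⟩
  · rw [← LinearMap.comp_assoc, hr]; rfl
  · calc _ = push S D.mkQ (push S r s) := rfl
      _ = s := by rw [push_push, hr]; simp

lemma rep_ofLin (f : X →ₗ[ℝ] Y) : rep (DecMap.ofLin _ f) = ofLin S f :=
  rep_eq_mk _ _ _ _ rfl rfl (map_zero _)

lemma comp_dec_aux (D : Submodule ℝ Y) (E : Submodule ℝ Z) (g : Y →ₗ[ℝ] Z) (s : Dec S Y)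
    (t : Dec S Z) :
    push S (compLocus D E (E.mkQ ∘ₗ g)).mkQ (t + push S g s) =
      push S (compMap D E (E.mkQ ∘ₗ g)) (push S D.mkQ s) +
        push S (Submodule.factor (le_compLocus D E (E.mkQ ∘ₗ g))) (push S E.mkQ t) := by
  simp only [map_add, push_push]
  rw [add_comm]
  rfl

lemma rep_comp (f : PreRel S X Y) (g : PreRel S Y Z) :
    rep (DecMap.comp f g) = (rep f).comp (rep g) := by
  refine rep_eq_mk _ _ _ _ ?_ rfl ?_
  · calc _ = PreRel.locus g ⊔ (PreRel.locus f).map g.lin := rfl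
      _ = compLocus (PreRel.locus f) (PreRel.locus g) ((PreRel.locus g).mkQ ∘ₗ g.lin) := by
        rw [compLocus, Submodule.map_comp, Submodule.comap_map_mkQ]
  · exact comp_dec_aux _ _ g.lin (PreRel.deco f) (PreRel.deco g)

lemma prodQuot_mk (D : Submodule ℝ X) (E : Submodule ℝ Y) (x : X) (y : Y) :
    prodQuot D E (D.mkQ x, E.mkQ y) = (D.prod E).mkQ (x, y) := by
  simp only [prodQuot, LinearMap.coprod_apply, Submodule.mkQ_apply, Submodule.mapQ_apply,
    ← Submodule.Quotient.mk_add]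
  simp

lemma tensor_dec_aux (D : Submodule ℝ X) (E : Submodule ℝ Y) (s : Dec S X) (t : Dec S Y) :
    push S (D.prod E).mkQ (decSum S s t) =
      push S (prodQuot D E) (decSum S (push S D.mkQ s) (push S E.mkQ t)) := by
  simp only [decSum, map_add, push_push]
  congr 1 <;> refine push_congr S (fun x => ?_) _
  · exact (prodQuot_mk D E x 0).symm.trans (by simp)
  · exact (prodQuot_mk D E 0 x).symm.trans (by simp)

lemma rep_tensor (f : PreRel S X Y) (g : PreRel S X' Y') :
    rep (DecMap.tensor f g) = (rep f).tensor (rep g) := by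
  refine rep_eq_mk _ _ _ _ ?_ ?_ ?_
  · calc _ = (PreRel.locus f).map (LinearMap.inl ℝ Y Y') ⊔
          (PreRel.locus g).map (LinearMap.inr ℝ Y Y') := rfl
      _ = (PreRel.locus f).prod (PreRel.locus g) := by
        rw [← LinearMap.coprod_map_prod, LinearMap.coprod_inl_inr, Submodule.map_id]
  · exact LinearMap.ext fun x => (prodQuot_mk _ _ _ _).symm
  · exact tensor_dec_aux _ _ (PreRel.deco f) (PreRel.deco g)

lemma id_comp (f : DecRel S X Y) : (ofLin S LinearMap.id).comp f = f := by
  obtain ⟨f, rfl⟩ := rep_surjective f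
  rw [← rep_ofLin, ← rep_comp, DecMap.id_comp]

lemma comp_id (f : DecRel S X Y) : f.comp (ofLin S LinearMap.id) = f := by
  obtain ⟨f, rfl⟩ := rep_surjective f
  rw [← rep_ofLin, ← rep_comp, DecMap.comp_id]

lemma assoc (f : DecRel S X Y) (g : DecRel S Y Z) (h : DecRel S Z W) :
    (f.comp g).comp h = f.comp (g.comp h) := by
  obtain ⟨f, rfl⟩ := rep_surjective f
  obtain ⟨g, rfl⟩ := rep_surjective g
  obtain ⟨h, rfl⟩ := rep_surjective h
  simp only [← rep_comp, DecMap.assoc]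

lemma ofLin_comp (f : X →ₗ[ℝ] Y) (g : Y →ₗ[ℝ] Z) :
    (ofLin S f).comp (ofLin S g) = ofLin S (g ∘ₗ f) := by
  simp only [← rep_ofLin, ← rep_comp, DecMap.ofLin_comp]

lemma ofLin_tensor (f : X →ₗ[ℝ] Y) (g : X' →ₗ[ℝ] Y') :
    (ofLin S f).tensor (ofLin S g) = ofLin S (f.prodMap g) := by
  simp only [← rep_ofLin, ← rep_tensor, DecMap.ofLin_tensor]

lemma tensor_comp_tensor (f : DecRel S X Y) (f' : DecRel S X' Y') (g : DecRel S Y Z)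
    (g' : DecRel S Y' Z') :
    (f.tensor f').comp (g.tensor g') = (f.comp g).tensor (f'.comp g') := by
  obtain ⟨f, rfl⟩ := rep_surjective f
  obtain ⟨f', rfl⟩ := rep_surjective f'
  obtain ⟨g, rfl⟩ := rep_surjective g
  obtain ⟨g', rfl⟩ := rep_surjective g'
  simp only [← rep_comp, ← rep_tensor, DecMap.tensor_comp_tensor]

lemma assoc_nat (f : DecRel S X Y) (g : DecRel S X' Y') (h : DecRel S Z W) :
    ((f.tensor g).tensor h).comp (ofLin S (LinearEquiv.prodAssoc ℝ Y Y' W).toLinearMap) =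
      (ofLin S (LinearEquiv.prodAssoc ℝ X X' Z).toLinearMap).comp (f.tensor (g.tensor h)) := by
  obtain ⟨f, rfl⟩ := rep_surjective f
  obtain ⟨g, rfl⟩ := rep_surjective g
  obtain ⟨h, rfl⟩ := rep_surjective h
  simp only [← rep_comp, ← rep_tensor, ← rep_ofLin, DecMap.assoc_nat]

lemma left_nat (f : DecRel S X Y) :
    ((ofLin S (LinearMap.id : PUnit.{u + 1} →ₗ[ℝ] PUnit.{u + 1})).tensor f).comp
        (ofLin S (LinearMap.snd ℝ PUnit.{u + 1} Y)) =
      (ofLin S (LinearMap.snd ℝ PUnit.{u + 1} X)).comp f := by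
  obtain ⟨f, rfl⟩ := rep_surjective f
  simp only [← rep_comp, ← rep_tensor, ← rep_ofLin, DecMap.left_nat]

lemma right_nat (f : DecRel S X Y) :
    (f.tensor (ofLin S (LinearMap.id : PUnit.{u + 1} →ₗ[ℝ] PUnit.{u + 1}))).comp
        (ofLin S (LinearMap.fst ℝ Y PUnit.{u + 1})) =
      (ofLin S (LinearMap.fst ℝ X PUnit.{u + 1})).comp f := by
  obtain ⟨f, rfl⟩ := rep_surjective f
  simp only [← rep_comp, ← rep_tensor, ← rep_ofLin, DecMap.right_nat]

lemma braid_nat (f : DecRel S X Y) (g : DecRel S X' Y') :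
    (f.tensor g).comp (ofLin S (LinearEquiv.prodComm ℝ Y Y').toLinearMap) =
      (ofLin S (LinearEquiv.prodComm ℝ X X').toLinearMap).comp (g.tensor f) := by
  obtain ⟨f, rfl⟩ := rep_surjective f
  obtain ⟨g, rfl⟩ := rep_surjective g
  simp only [← rep_comp, ← rep_tensor, ← rep_ofLin, DecMap.braid_nat]

lemma eq_of_subsingleton [Subsingleton Y] [Subsingleton (Dec S Y)] (f g : DecRel S X Y) :
    f = g := by
  obtain ⟨f, rfl⟩ := rep_surjective f
  obtain ⟨g, rfl⟩ := rep_surjective g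
  have : Subsingleton (Dec (prodFunctor S subFunctor.{u}) Y) :=
    inferInstanceAs (Subsingleton (Dec S Y × Submodule ℝ Y))
  rw [DecMap.eq_of_subsingleton f g]

end DecRel

end Unbundled

/-- The category `Lin_S`: objects are finite-dimensional real vector spaces, morphisms are
`S`-decorated linear maps. -/
structure Lin (S : DecorationFunctor.{u, v}) : Type (u + 1) where
  /-- View a vector space as an object of the category. -/
  of ::
  /-- The underlying finite-dimensional vector space. -/
  vec : FGModuleCat.{u} ℝ

namespace Lin

variable {S : DecorationFunctor.{u, v}}

instance : Category.{max u v} (Lin S) where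
  Hom X Y := DecMap S X.vec Y.vec
  id _ := DecMap.ofLin S LinearMap.id
  comp f g := DecMap.comp f g
  id_comp f := DecMap.id_comp f
  comp_id f := DecMap.comp_id f
  assoc f g h := DecMap.assoc f g h

/-- The inclusion of linear maps, sending `f` to `(f, 0)`. -/
def incl {X Y : Lin S} (f : X.vec →ₗ[ℝ] Y.vec) : X ⟶ Y := DecMap.ofLin S f

lemma incl_comp {X Y Z : Lin S} (f : X.vec →ₗ[ℝ] Y.vec) (g : Y.vec →ₗ[ℝ] Z.vec) :
    (incl f : X ⟶ Y) ≫ (incl g : Y ⟶ Z) = incl (g ∘ₗ f) := DecMap.ofLin_comp f g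

lemma incl_id (X : Lin S) : incl LinearMap.id = 𝟙 X := rfl

/-- Linear isomorphisms are isomorphisms. -/
def inclIso {X Y : Lin S} (e : X.vec ≃ₗ[ℝ] Y.vec) : X ≅ Y where
  hom := incl e.toLinearMap
  inv := incl e.symm.toLinearMap
  hom_inv_id := by rw [incl_comp, ← incl_id]; simp
  inv_hom_id := by rw [incl_comp, ← incl_id]; simp

/-- The tensor product of objects is the product `X × Y` of vector spaces, the unit object is the
zero space, and all structure maps come from linear maps. -/
instance : MonoidalCategoryStruct (Lin S) where
  tensorObj X Y := ⟨FGModuleCat.of ℝ (X.vec × Y.vec)⟩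
  tensorHom f g := DecMap.tensor f g
  whiskerLeft X _ _ f := DecMap.tensor (DecMap.ofLin S (LinearMap.id : X.vec →ₗ[ℝ] X.vec)) f
  whiskerRight f Y := DecMap.tensor f (DecMap.ofLin S (LinearMap.id : Y.vec →ₗ[ℝ] Y.vec))
  tensorUnit := ⟨FGModuleCat.of ℝ PUnit.{u + 1}⟩
  associator X Y Z := inclIso (LinearEquiv.prodAssoc ℝ X.vec Y.vec Z.vec)
  leftUnitor X := inclIso (LinearEquiv.uniqueProd : (PUnit.{u + 1} × X.vec) ≃ₗ[ℝ] X.vec)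
  rightUnitor X := inclIso (LinearEquiv.prodUnique : (X.vec × PUnit.{u + 1}) ≃ₗ[ℝ] X.vec)

lemma incl_tensor {X Y X' Y' : Lin S} (f : X.vec →ₗ[ℝ] Y.vec) (g : X'.vec →ₗ[ℝ] Y'.vec) :
    (incl f : X ⟶ Y) ⊗ₘ (incl g : X' ⟶ Y') =
      (incl (f.prodMap g) : X ⊗ X' ⟶ Y ⊗ Y') := DecMap.ofLin_tensor f g

instance : MonoidalCategory (Lin S) := MonoidalCategory.ofTensorHom
  (id_tensorHom_id := fun X Y => (DecMap.ofLin_tensor _ _).trans (by rw [LinearMap.prodMap_id]; rfl))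
  (id_tensorHom := fun _ _ _ _ => rfl)
  (tensorHom_id := fun _ _ => rfl)
  (tensorHom_comp_tensorHom := fun f f' g g' => DecMap.tensor_comp_tensor f f' g g')
  (associator_naturality := fun f g h => DecMap.assoc_nat f g h)
  (leftUnitor_naturality := fun f => DecMap.left_nat f)
  (rightUnitor_naturality := fun f => DecMap.right_nat f)
  (pentagon := fun W X Y Z => by
    change (DecMap.comp (DecMap.tensor (DecMap.ofLin S _) (DecMap.ofLin S _))
      (DecMap.comp (DecMap.ofLin S _)
      (DecMap.tensor (DecMap.ofLin S _) (DecMap.ofLin S _)))) =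
      (DecMap.comp (DecMap.ofLin S _)
      (DecMap.ofLin S _))
    simp only [DecMap.ofLin_tensor, DecMap.ofLin_comp]
    rfl)
  (triangle := fun X Y => by
    change (DecMap.comp (DecMap.ofLin S _)
      (DecMap.tensor (DecMap.ofLin S _) (DecMap.ofLin S _))) =
      (DecMap.tensor (DecMap.ofLin S _) (DecMap.ofLin S _))
    simp only [DecMap.ofLin_tensor, DecMap.ofLin_comp]
    rfl)

instance : SymmetricCategory (Lin S) where
  braiding X Y := inclIso (LinearEquiv.prodComm ℝ X.vec Y.vec)
  braiding_naturality_right _ _ _ f := DecMap.braid_nat _ f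
  braiding_naturality_left f _ := DecMap.braid_nat f _
  hexagon_forward X Y Z := by
    change (DecMap.comp (DecMap.ofLin S _)
      (DecMap.comp (DecMap.ofLin S _)
      (DecMap.ofLin S _))) =
      (DecMap.comp (DecMap.tensor (DecMap.ofLin S _) (DecMap.ofLin S _))
      (DecMap.comp (DecMap.ofLin S _)
      (DecMap.tensor (DecMap.ofLin S _) (DecMap.ofLin S _))))
    simp only [DecMap.ofLin_tensor, DecMap.ofLin_comp]
    rfl
  hexagon_reverse X Y Z := by
    change (DecMap.comp (DecMap.ofLin S _)
      (DecMap.comp (DecMap.ofLin S _)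
      (DecMap.ofLin S _))) =
      (DecMap.comp (DecMap.tensor (DecMap.ofLin S _) (DecMap.ofLin S _))
      (DecMap.comp (DecMap.ofLin S _)
      (DecMap.tensor (DecMap.ofLin S _) (DecMap.ofLin S _))))
    simp only [DecMap.ofLin_tensor, DecMap.ofLin_comp]
    rfl
  symmetry X Y := DecMap.ofLin_comp _ _

/-- Discarding is the linear map `X → 0`, and copying is the diagonal `x ↦ (x, x)`. -/
instance (X : Lin S) : ComonObj X where
  counit := incl (0 : X.vec →ₗ[ℝ] PUnit.{u + 1})
  comul := incl (LinearMap.prod LinearMap.id LinearMap.id : X.vec →ₗ[ℝ] X.vec × X.vec)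
  counit_comul := by
    change (DecMap.comp (DecMap.ofLin S _)
      (DecMap.tensor (DecMap.ofLin S _) (DecMap.ofLin S _))) =
      (DecMap.ofLin S _)
    simp only [DecMap.ofLin_tensor, DecMap.ofLin_comp]
    rfl
  comul_counit := by
    change (DecMap.comp (DecMap.ofLin S _)
      (DecMap.tensor (DecMap.ofLin S _) (DecMap.ofLin S _))) =
      (DecMap.ofLin S _)
    simp only [DecMap.ofLin_tensor, DecMap.ofLin_comp]
    rfl
  comul_assoc := by
    change (DecMap.comp (DecMap.ofLin S _)
      (DecMap.tensor (DecMap.ofLin S _) (DecMap.ofLin S _))) =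
      (DecMap.comp (DecMap.ofLin S _)
      (DecMap.comp (DecMap.tensor (DecMap.ofLin S _) (DecMap.ofLin S _))
      (DecMap.ofLin S _)))
    simp only [DecMap.ofLin_tensor, DecMap.ofLin_comp]
    rfl

instance (X : Lin S) : IsCommComonObj X where
  comul_comm := DecMap.ofLin_comp _ _

instance : CopyDiscardCategory (Lin S) where
  copy_tensor X Y := by
    change (DecMap.ofLin S _) =
      (DecMap.comp (DecMap.tensor (DecMap.ofLin S _) (DecMap.ofLin S _))
      (DecMap.comp (DecMap.ofLin S _)
      (DecMap.comp (DecMap.tensor (DecMap.ofLin S _) (DecMap.ofLin S _))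
      (DecMap.comp (DecMap.tensor (DecMap.ofLin S _) (DecMap.tensor (DecMap.ofLin S _) (DecMap.ofLin S _)))
      (DecMap.comp (DecMap.tensor (DecMap.ofLin S _) (DecMap.ofLin S _))
      (DecMap.ofLin S _))))))
    simp only [DecMap.ofLin_tensor, DecMap.ofLin_comp]
    rfl
  discard_tensor X Y := by
    change (DecMap.ofLin S _) =
      (DecMap.comp (DecMap.tensor (DecMap.ofLin S _) (DecMap.ofLin S _))
      (DecMap.ofLin S _))
    simp only [DecMap.ofLin_tensor, DecMap.ofLin_comp]
    rfl
  copy_unit := rfl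
  discard_unit := rfl

/-- If `S(0)` is trivial, then discarding is natural, i.e. we have a Markov category. -/
instance [Subsingleton (Dec S PUnit.{u + 1})] : MarkovCategory (Lin S) where
  discard_natural _ := DecMap.eq_of_subsingleton (Y := PUnit.{u + 1}) _ _

end Lin

/-- The category `LinRel_S`: objects are finite-dimensional real vector spaces, morphisms are
`S`-decorated linear relations. -/
structure LinRel (S : DecorationFunctor.{u, v}) : Type (u + 1) where
  /-- View a vector space as an object of the category. -/
  of ::
  /-- The underlying finite-dimensional vector space. -/
  vec : FGModuleCat.{u} ℝ

namespace LinRel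

variable {S : DecorationFunctor.{u, v}}

instance : Category.{max u v} (LinRel S) where
  Hom X Y := DecRel S X.vec Y.vec
  id _ := DecRel.ofLin S LinearMap.id
  comp f g := DecRel.comp f g
  id_comp f := DecRel.id_comp f
  comp_id f := DecRel.comp_id f
  assoc f g h := DecRel.assoc f g h

/-- The inclusion of linear maps, with locus of nondeterminism `0` and decoration `0`. -/
def incl {X Y : LinRel S} (f : X.vec →ₗ[ℝ] Y.vec) : X ⟶ Y := DecRel.ofLin S f

lemma incl_comp {X Y Z : LinRel S} (f : X.vec →ₗ[ℝ] Y.vec) (g : Y.vec →ₗ[ℝ] Z.vec) :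
    (incl f : X ⟶ Y) ≫ (incl g : Y ⟶ Z) = incl (g ∘ₗ f) := DecRel.ofLin_comp f g

lemma incl_id (X : LinRel S) : incl LinearMap.id = 𝟙 X := rfl

/-- Linear isomorphisms are isomorphisms. -/
def inclIso {X Y : LinRel S} (e : X.vec ≃ₗ[ℝ] Y.vec) : X ≅ Y where
  hom := incl e.toLinearMap
  inv := incl e.symm.toLinearMap
  hom_inv_id := by rw [incl_comp, ← incl_id]; simp
  inv_hom_id := by rw [incl_comp, ← incl_id]; simp

/-- The tensor product of objects is the product `X × Y` of vector spaces, the unit object is the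
zero space, and all structure maps come from linear maps. -/
instance : MonoidalCategoryStruct (LinRel S) where
  tensorObj X Y := ⟨FGModuleCat.of ℝ (X.vec × Y.vec)⟩
  tensorHom f g := DecRel.tensor f g
  whiskerLeft X _ _ f := DecRel.tensor (DecRel.ofLin S (LinearMap.id : X.vec →ₗ[ℝ] X.vec)) f
  whiskerRight f Y := DecRel.tensor f (DecRel.ofLin S (LinearMap.id : Y.vec →ₗ[ℝ] Y.vec))
  tensorUnit := ⟨FGModuleCat.of ℝ PUnit.{u + 1}⟩
  associator X Y Z := inclIso (LinearEquiv.prodAssoc ℝ X.vec Y.vec Z.vec)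
  leftUnitor X := inclIso (LinearEquiv.uniqueProd : (PUnit.{u + 1} × X.vec) ≃ₗ[ℝ] X.vec)
  rightUnitor X := inclIso (LinearEquiv.prodUnique : (X.vec × PUnit.{u + 1}) ≃ₗ[ℝ] X.vec)

lemma incl_tensor {X Y X' Y' : LinRel S} (f : X.vec →ₗ[ℝ] Y.vec) (g : X'.vec →ₗ[ℝ] Y'.vec) :
    (incl f : X ⟶ Y) ⊗ₘ (incl g : X' ⟶ Y') =
      (incl (f.prodMap g) : X ⊗ X' ⟶ Y ⊗ Y') := DecRel.ofLin_tensor f g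

instance : MonoidalCategory (LinRel S) := MonoidalCategory.ofTensorHom
  (id_tensorHom_id := fun X Y => (DecRel.ofLin_tensor _ _).trans (by rw [LinearMap.prodMap_id]; rfl))
  (id_tensorHom := fun _ _ _ _ => rfl)
  (tensorHom_id := fun _ _ => rfl)
  (tensorHom_comp_tensorHom := fun f f' g g' => DecRel.tensor_comp_tensor f f' g g')
  (associator_naturality := fun f g h => DecRel.assoc_nat f g h)
  (leftUnitor_naturality := fun f => DecRel.left_nat f)
  (rightUnitor_naturality := fun f => DecRel.right_nat f)
  (pentagon := fun W X Y Z => by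
    change (DecRel.comp (DecRel.tensor (DecRel.ofLin S _) (DecRel.ofLin S _))
      (DecRel.comp (DecRel.ofLin S _)
      (DecRel.tensor (DecRel.ofLin S _) (DecRel.ofLin S _)))) =
      (DecRel.comp (DecRel.ofLin S _)
      (DecRel.ofLin S _))
    simp only [DecRel.ofLin_tensor, DecRel.ofLin_comp]
    rfl)
  (triangle := fun X Y => by
    change (DecRel.comp (DecRel.ofLin S _)
      (DecRel.tensor (DecRel.ofLin S _) (DecRel.ofLin S _))) =
      (DecRel.tensor (DecRel.ofLin S _) (DecRel.ofLin S _))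
    simp only [DecRel.ofLin_tensor, DecRel.ofLin_comp]
    rfl)

instance : SymmetricCategory (LinRel S) where
  braiding X Y := inclIso (LinearEquiv.prodComm ℝ X.vec Y.vec)
  braiding_naturality_right _ _ _ f := DecRel.braid_nat _ f
  braiding_naturality_left f _ := DecRel.braid_nat f _
  hexagon_forward X Y Z := by
    change (DecRel.comp (DecRel.ofLin S _)
      (DecRel.comp (DecRel.ofLin S _)
      (DecRel.ofLin S _))) =
      (DecRel.comp (DecRel.tensor (DecRel.ofLin S _) (DecRel.ofLin S _))
      (DecRel.comp (DecRel.ofLin S _)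
      (DecRel.tensor (DecRel.ofLin S _) (DecRel.ofLin S _))))
    simp only [DecRel.ofLin_tensor, DecRel.ofLin_comp]
    rfl
  hexagon_reverse X Y Z := by
    change (DecRel.comp (DecRel.ofLin S _)
      (DecRel.comp (DecRel.ofLin S _)
      (DecRel.ofLin S _))) =
      (DecRel.comp (DecRel.tensor (DecRel.ofLin S _) (DecRel.ofLin S _))
      (DecRel.comp (DecRel.ofLin S _)
      (DecRel.tensor (DecRel.ofLin S _) (DecRel.ofLin S _))))
    simp only [DecRel.ofLin_tensor, DecRel.ofLin_comp]
    rfl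
  symmetry X Y := DecRel.ofLin_comp _ _

/-- Discarding is the linear map `X → 0`, and copying is the diagonal `x ↦ (x, x)`. -/
instance (X : LinRel S) : ComonObj X where
  counit := incl (0 : X.vec →ₗ[ℝ] PUnit.{u + 1})
  comul := incl (LinearMap.prod LinearMap.id LinearMap.id : X.vec →ₗ[ℝ] X.vec × X.vec)
  counit_comul := by
    change (DecRel.comp (DecRel.ofLin S _)
      (DecRel.tensor (DecRel.ofLin S _) (DecRel.ofLin S _))) =
      (DecRel.ofLin S _)
    simp only [DecRel.ofLin_tensor, DecRel.ofLin_comp]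
    rfl
  comul_counit := by
    change (DecRel.comp (DecRel.ofLin S _)
      (DecRel.tensor (DecRel.ofLin S _) (DecRel.ofLin S _))) =
      (DecRel.ofLin S _)
    simp only [DecRel.ofLin_tensor, DecRel.ofLin_comp]
    rfl
  comul_assoc := by
    change (DecRel.comp (DecRel.ofLin S _)
      (DecRel.tensor (DecRel.ofLin S _) (DecRel.ofLin S _))) =
      (DecRel.comp (DecRel.ofLin S _)
      (DecRel.comp (DecRel.tensor (DecRel.ofLin S _) (DecRel.ofLin S _))
      (DecRel.ofLin S _)))
    simp only [DecRel.ofLin_tensor, DecRel.ofLin_comp]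
    rfl

instance (X : LinRel S) : IsCommComonObj X where
  comul_comm := DecRel.ofLin_comp _ _

instance : CopyDiscardCategory (LinRel S) where
  copy_tensor X Y := by
    change (DecRel.ofLin S _) =
      (DecRel.comp (DecRel.tensor (DecRel.ofLin S _) (DecRel.ofLin S _))
      (DecRel.comp (DecRel.ofLin S _)
      (DecRel.comp (DecRel.tensor (DecRel.ofLin S _) (DecRel.ofLin S _))
      (DecRel.comp (DecRel.tensor (DecRel.ofLin S _) (DecRel.tensor (DecRel.ofLin S _) (DecRel.ofLin S _)))
      (DecRel.comp (DecRel.tensor (DecRel.ofLin S _) (DecRel.ofLin S _))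
      (DecRel.ofLin S _))))))
    simp only [DecRel.ofLin_tensor, DecRel.ofLin_comp]
    rfl
  discard_tensor X Y := by
    change (DecRel.ofLin S _) =
      (DecRel.comp (DecRel.tensor (DecRel.ofLin S _) (DecRel.ofLin S _))
      (DecRel.ofLin S _))
    simp only [DecRel.ofLin_tensor, DecRel.ofLin_comp]
    rfl
  copy_unit := rfl
  discard_unit := rfl

/-- If `S(0)` is trivial, then discarding is natural, i.e. we have a Markov category. -/
instance [Subsingleton (Dec S PUnit.{u + 1})] : MarkovCategory (LinRel S) where
  discard_natural _ := DecRel.eq_of_subsingleton (Y := PUnit.{u + 1}) _ _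

end LinRel

end DecoratedLinear

/-!
A decorated relation `A → X × Y` is represented by a triple `(φ, s, D)`. Let `D_X` be the projection
of the locus `D` to `X` and let `E = {y | (0, y) ∈ D}`. Over a field there is a linear map
`c : X → Y` whose graph over `D_X` lies in `D` (`exists_graph_mem`), so the shear
`(x, y) ↦ (x, y - c x)` carries `D` to `D_X × E`. Composing it with the two quotient maps gives a
surjection `X × Y → X/D_X × Y/E` with kernel exactly `D` (`shearQuot`); a decorated relation with
locus `D` is therefore the same thing as a decorated linear map into the product `X/D_X × Y/E`
(`rep_eq_rep_of_ker`). Conditionals in `Lin_S` provide a conditional `(γ', t')` of that map, and with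
a linear section `r` of `Y → Y/E` the triple `((x, a) ↦ c x + r (γ' ([x], a)), S(r)(t'), E)`
represents a conditional of the original relation.

Passing between the two categories is harmless because `DecRel.rep` commutes with all the operations
in the definition of conditionals, and because the process that reconstructs a morphism from its
marginal and a conditional has the same closed form for every decoration functor (`DecMap.process_eq`).
-/

namespace DecoratedLinear

section

set_option linter.unusedSectionVars false

variable {S : DecorationFunctor.{u, v}}
variable {A X Y Z : Type u}
  [AddCommGroup A] [Module ℝ A] [Module.Finite ℝ A]
  [AddCommGroup X] [Module ℝ X] [Module.Finite ℝ X]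
  [AddCommGroup Y] [Module ℝ Y] [Module.Finite ℝ Y]
  [AddCommGroup Z] [Module ℝ Z] [Module.Finite ℝ Z]

/-! ### Recombining a marginal with a conditional -/

/-- The process on the right-hand side of the defining equation of conditionals, for decorated
linear maps: the marginal of `f` on `X`, recombined with the candidate conditional `g`. -/
def DecMap.process (f : DecMap S A (X × Y)) (g : DecMap S (X × A) Y) : DecMap S A (X × Y) :=
  (ofLin S (LinearMap.prod LinearMap.id LinearMap.id : A →ₗ[ℝ] A × A)).comp
    (((f.comp (((ofLin S LinearMap.id).tensor (ofLin S (0 : Y →ₗ[ℝ] PUnit.{u + 1}))).comp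
        (ofLin S (LinearEquiv.prodUnique : (X × PUnit.{u + 1}) ≃ₗ[ℝ] X).toLinearMap))).tensor
      (ofLin S LinearMap.id)).comp
    (((ofLin S (LinearMap.prod LinearMap.id LinearMap.id : X →ₗ[ℝ] X × X)).tensor
      (ofLin S (LinearMap.id : A →ₗ[ℝ] A))).comp
    ((ofLin S (LinearEquiv.prodAssoc ℝ X X A).toLinearMap).comp
      ((ofLin S LinearMap.id).tensor g))))

/-- The process on the right-hand side of the defining equation of conditionals, for decorated
linear relations. -/
def DecRel.process (f : DecRel S A (X × Y)) (g : DecRel S (X × A) Y) : DecRel S A (X × Y) :=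
  (ofLin S (LinearMap.prod LinearMap.id LinearMap.id : A →ₗ[ℝ] A × A)).comp
    (((f.comp (((ofLin S LinearMap.id).tensor (ofLin S (0 : Y →ₗ[ℝ] PUnit.{u + 1}))).comp
        (ofLin S (LinearEquiv.prodUnique : (X × PUnit.{u + 1}) ≃ₗ[ℝ] X).toLinearMap))).tensor
      (ofLin S LinearMap.id)).comp
    (((ofLin S (LinearMap.prod LinearMap.id LinearMap.id : X →ₗ[ℝ] X × X)).tensor
      (ofLin S (LinearMap.id : A →ₗ[ℝ] A))).comp
    ((ofLin S (LinearEquiv.prodAssoc ℝ X X A).toLinearMap).comp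
      ((ofLin S LinearMap.id).tensor g))))

lemma DecRel.rep_process (f : PreRel S A (X × Y)) (g : PreRel S (X × A) Y) :
    rep (DecMap.process f g) = DecRel.process (rep f) (rep g) := by
  simp only [DecMap.process, DecRel.process, rep_comp, rep_tensor, rep_ofLin]

/-- The closed form of the process. The decoration of `f` enters only through its marginal `s_X`,
which is copied, so it contributes along `x ↦ (x, g (x, 0))`. -/
lemma DecMap.process_eq (f : DecMap S A (X × Y)) (g : DecMap S (X × A) Y) :
    DecMap.process f g =
      ⟨(LinearMap.fst ℝ X Y ∘ₗ f.lin).prod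
          (g.lin ∘ₗ (LinearMap.fst ℝ X Y ∘ₗ f.lin).prod LinearMap.id),
        push S (LinearMap.id.prod (g.lin ∘ₗ LinearMap.inl ℝ X A) ∘ₗ LinearMap.fst ℝ X Y) f.dec +
          push S (LinearMap.inr ℝ X Y) g.dec⟩ := by
  ext1
  · rfl
  · simp only [process, comp_dec, tensor_dec, ofLin_dec, ofLin_lin, comp_lin, tensor_lin, decSum,
      push_push, map_zero, zero_add, add_zero]
    rw [add_comm]
    rfl

/-! ### Splitting the locus of nondeterminism -/

/-- Two triples represent the same decorated relation as soon as they have the same locus and agree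
after a surjection whose kernel is that locus. -/
lemma DecRel.rep_eq_rep_of_ker {p q : PreRel S A X} (P : X →ₗ[ℝ] Z) (hP : Function.Surjective P)
    (hp : LinearMap.ker P = PreRel.locus p) (hq : PreRel.locus q = PreRel.locus p)
    (hlin : P ∘ₗ p.lin = P ∘ₗ q.lin)
    (hdec : push S P (PreRel.deco p) = push S P (PreRel.deco q)) :
    rep p = rep q := by
  obtain ⟨r, hr⟩ := P.exists_rightInverse_of_surjective (LinearMap.range_eq_top.2 hP)
  have hfac : (PreRel.locus p).mkQ = ((PreRel.locus p).mkQ ∘ₗ r) ∘ₗ P := by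
    ext x
    refine (Submodule.Quotient.eq _).2 ?_
    have hrx : P (r (P x)) = P x := LinearMap.congr_fun hr (P x)
    rw [← hp]
    simp [hrx]
  refine (rep_eq_mk q _ _ _ hq ?_ ?_).symm
  · rw [hfac]
    exact congrArg (((PreRel.locus p).mkQ ∘ₗ r) ∘ₗ ·) hlin.symm
  · rw [hfac, ← push_push S _ P (PreRel.deco q), ← push_push S _ P (PreRel.deco p), hdec]

/-- A subspace of `X × Y` contains the graph, over its projection to `X`, of some linear map. -/
lemma exists_graph_mem (D : Submodule ℝ (X × Y)) :
    ∃ c : X →ₗ[ℝ] Y, ∀ x ∈ D.map (LinearMap.fst ℝ X Y), (x, c x) ∈ D := by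
  let p := (LinearMap.fst ℝ X Y).submoduleMap D
  obtain ⟨r, hr⟩ := p.exists_rightInverse_of_surjective
    (LinearMap.range_eq_top.2 ((LinearMap.fst ℝ X Y).submoduleMap_surjective D))
  obtain ⟨c, hc⟩ := (LinearMap.snd ℝ X Y ∘ₗ D.subtype ∘ₗ r).exists_extend
  refine ⟨c, fun x hx => ?_⟩
  have h1 : ((r ⟨x, hx⟩ : D) : X × Y).1 = x :=
    congrArg Subtype.val (LinearMap.congr_fun hr ⟨x, hx⟩)
  have h2 : c x = ((r ⟨x, hx⟩ : D) : X × Y).2 := LinearMap.congr_fun hc ⟨x, hx⟩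
  have h3 : (x, c x) = ((r ⟨x, hx⟩ : D) : X × Y) := Prod.ext h1.symm h2
  exact h3 ▸ (r ⟨x, hx⟩).2

/-- The map `X × Y → X/D_X × Y/E`, `(x, y) ↦ ([x], [y - c x])`, where `D_X` is the projection of `D`
and `E` its fibre over `0`. -/
def shearQuot (D : Submodule ℝ (X × Y)) (c : X →ₗ[ℝ] Y) :
    X × Y →ₗ[ℝ] (X ⧸ D.map (LinearMap.fst ℝ X Y)) × (Y ⧸ D.comap (LinearMap.inr ℝ X Y)) :=
  ((D.map (LinearMap.fst ℝ X Y)).mkQ ∘ₗ LinearMap.fst ℝ X Y).prod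
    ((D.comap (LinearMap.inr ℝ X Y)).mkQ ∘ₗ (LinearMap.snd ℝ X Y - c ∘ₗ LinearMap.fst ℝ X Y))

lemma shearQuot_apply (D : Submodule ℝ (X × Y)) (c : X →ₗ[ℝ] Y) (x : X) (y : Y) :
    shearQuot D c (x, y) = ((D.map (LinearMap.fst ℝ X Y)).mkQ x,
      (D.comap (LinearMap.inr ℝ X Y)).mkQ (y - c x)) := rfl

lemma shearQuot_surjective (D : Submodule ℝ (X × Y)) (c : X →ₗ[ℝ] Y) :
    Function.Surjective (shearQuot D c) := by
  rintro ⟨x, y⟩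
  obtain ⟨x, rfl⟩ := Submodule.mkQ_surjective _ x
  obtain ⟨y, rfl⟩ := Submodule.mkQ_surjective _ y
  exact ⟨(x, y + c x), by rw [shearQuot_apply, add_sub_cancel_right]⟩

lemma ker_shearQuot {D : Submodule ℝ (X × Y)} {c : X →ₗ[ℝ] Y}
    (hc : ∀ x ∈ D.map (LinearMap.fst ℝ X Y), (x, c x) ∈ D) :
    LinearMap.ker (shearQuot D c) = D := by
  ext ⟨x, y⟩
  have hmem : (x, y) ∈ LinearMap.ker (shearQuot D c) ↔
      x ∈ D.map (LinearMap.fst ℝ X Y) ∧ (0, y - c x) ∈ D := by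
    rw [LinearMap.mem_ker, shearQuot_apply, Prod.mk_eq_zero, Submodule.mkQ_apply,
      Submodule.mkQ_apply, Submodule.Quotient.mk_eq_zero, Submodule.Quotient.mk_eq_zero]
    rfl
  rw [hmem]
  constructor
  · rintro ⟨hx, hy⟩
    simpa using D.add_mem (hc x hx) hy
  · intro h
    have hx : x ∈ D.map (LinearMap.fst ℝ X Y) := ⟨(x, y), h, rfl⟩
    exact ⟨hx, by simpa using D.sub_mem h (hc x hx)⟩

/-- A subspace of `X × Y` is recovered from its projection to `X` and its fibre `E` over `0`. The
map moving the projection into `X × Y` need only agree with `c` modulo `E`. -/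
lemma locus_recombine {D : Submodule ℝ (X × Y)} {c b : X →ₗ[ℝ] Y}
    (hc : ∀ x ∈ D.map (LinearMap.fst ℝ X Y), (x, c x) ∈ D)
    (hb : ∀ x ∈ D.map (LinearMap.fst ℝ X Y), b x - c x ∈ D.comap (LinearMap.inr ℝ X Y)) :
    D.map (LinearMap.id.prod b ∘ₗ LinearMap.fst ℝ X Y) ⊔
      (D.comap (LinearMap.inr ℝ X Y)).map (LinearMap.inr ℝ X Y) = D := by
  have hcb : ∀ x ∈ D.map (LinearMap.fst ℝ X Y), (x, b x) ∈ D := fun x hx => by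
    simpa using D.add_mem (hc x hx) (hb x hx)
  apply le_antisymm
  · refine sup_le ?_ (Submodule.map_comap_le _ _)
    rintro _ ⟨z, hz, rfl⟩
    exact hcb z.1 ⟨z, hz, rfl⟩
  · rintro ⟨x, y⟩ h
    have hx := hcb x ⟨(x, y), h, rfl⟩
    refine Submodule.mem_sup.2 ⟨(x, b x), ⟨(x, y), h, rfl⟩, (0, y - b x), ⟨y - b x, ?_, rfl⟩, ?_⟩
    · simpa using D.sub_mem h hx
    · simp

/-! ### Lifting conditionals -/

/-- If decorated linear maps have conditionals, then so does every triple representing a decorated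
relation, up to the equivalence of triples. -/
lemma exists_preRel_conditional
    (h : ∀ (X' Y' : Type u) [AddCommGroup X'] [Module ℝ X'] [Module.Finite ℝ X']
      [AddCommGroup Y'] [Module ℝ Y'] [Module.Finite ℝ Y'] (f : DecMap S A (X' × Y')),
      ∃ g : DecMap S (X' × A) Y', f = f.process g)
    (φ : A →ₗ[ℝ] X × Y) (s : Dec S (X × Y)) (D : Submodule ℝ (X × Y)) :
    ∃ g : PreRel S (X × A) Y,
      DecRel.rep (⟨φ, (s, D)⟩ : PreRel S A (X × Y)) =
        DecRel.rep (DecMap.process (⟨φ, (s, D)⟩ : PreRel S A (X × Y)) g) := by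
  obtain ⟨c, hc⟩ := exists_graph_mem D
  set DX := D.map (LinearMap.fst ℝ X Y)
  set E := D.comap (LinearMap.inr ℝ X Y)
  obtain ⟨⟨γ, t⟩, hg⟩ := h (X ⧸ DX) (Y ⧸ E) ⟨shearQuot D c ∘ₗ φ, push S (shearQuot D c) s⟩
  rw [DecMap.process_eq, DecMap.mk.injEq] at hg
  obtain ⟨hlin, hdec⟩ := hg
  dsimp only at hlin hdec
  obtain ⟨r, hr⟩ := E.mkQ.exists_rightInverse_of_surjective E.range_mkQ
  have hr' : ∀ y, E.mkQ (r y) = y := fun y => LinearMap.congr_fun hr y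
  let g : X × A →ₗ[ℝ] Y :=
    c ∘ₗ LinearMap.fst ℝ X A + r ∘ₗ γ ∘ₗ DX.mkQ.prodMap LinearMap.id
  have hg_apply : ∀ x a, g (x, a) = c x + r (γ (DX.mkQ x, a)) := fun _ _ => rfl
  -- After the shear, `c` disappears and `r` becomes invisible.
  have hshear : ∀ x a, shearQuot D c (x, g (x, a)) = (DX.mkQ x, γ (DX.mkQ x, a)) := by
    intro x a
    rw [shearQuot_apply, hg_apply, add_sub_cancel_left, hr']
  refine ⟨⟨g, (push S r t, E)⟩, ?_⟩
  rw [DecMap.process_eq]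
  refine DecRel.rep_eq_rep_of_ker (shearQuot D c) (shearQuot_surjective D c) (ker_shearQuot hc)
    ?_ ?_ ?_
  · refine locus_recombine (b := g ∘ₗ LinearMap.inl ℝ X A) hc fun x hx => ?_
    have hx0 : DX.mkQ x = 0 := (Submodule.Quotient.mk_eq_zero _).2 hx
    have h0 : ((0 : X ⧸ DX), (0 : A)) = 0 := rfl
    have : (g ∘ₗ LinearMap.inl ℝ X A) x = c x := by
      change g (x, 0) = c x
      rw [hg_apply, hx0, h0, map_zero, map_zero, add_zero]
    rw [this, sub_self]
    exact zero_mem _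
  · refine hlin.trans (LinearMap.ext fun a => ?_)
    exact (hshear (φ a).1 a).symm
  · change push S (shearQuot D c) s = push S (shearQuot D c)
      (push S (LinearMap.id.prod (g ∘ₗ LinearMap.inl ℝ X A) ∘ₗ LinearMap.fst ℝ X Y) s +
        push S (LinearMap.inr ℝ X Y) (push S r t))
    rw [hdec]
    simp only [map_add, push_push]
    congr 1
    · exact push_congr S (fun z => (hshear z.1 0).symm) s
    · refine push_congr S (fun y => ?_) t
      change (0, y) = shearQuot D c (0, r y)
      rw [shearQuot_apply, map_zero, map_zero, sub_zero, hr']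

end

end DecoratedLinear

theorem theorem3p5 (S : DecoratedLinear.DecorationFunctor.{u, v})
    (h : DecoratedLinear.HasConditionals (DecoratedLinear.Lin S)) :
    DecoratedLinear.HasConditionals (DecoratedLinear.LinRel S) := by
  intro A X Y f
  obtain ⟨⟨φ, s, D⟩, rfl⟩ := DecoratedLinear.DecRel.rep_surjective f
  obtain ⟨g, hg⟩ := DecoratedLinear.exists_preRel_conditional (fun X' Y' => by
    intro _ _ _ _ _ _ f'
    exact h ⟨A.vec⟩ ⟨FGModuleCat.of ℝ X'⟩ ⟨FGModuleCat.of ℝ Y'⟩ f') φ s D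
  exact ⟨DecoratedLinear.DecRel.rep g, hg.trans (DecoratedLinear.DecRel.rep_process _ g)⟩
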